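/- **Setting.** Let $A_0\ge 1$, $0<\delta\le \frac{1}{1000}A_0^{-10}$, and let $L\ge 0$, $M\ge 1$ be integers. Let $X$ be a set with a quasi-distance $d$: $d(x,y)=d(y,x)\ge 0$, $d(x,y)=0$ iff $x=y$, and $d(x,y)\le A_0(d(x,z)+d(z,y))$. Put $B(x,r)=\{y: d(x,y)<r\}$ and give $X$ the topology in which $U$ is open iff every $x\in U$ has some $B(x,r)\subseteq U$, $r>0$. Assume that $X$ is geometrically doubling: there is $N\in\mathbb N$ such that no ball of radius $r$ contains more than $N$ points at mutual quasi-distances exceeding $r/2$. *Reference points.* For each $k\in\mathbb Z$ let $\mathscr X^k=\{x^k_\alpha\}_\alpha\subseteq X$, with $\mathscr X^k\subseteq\mathscr X^{k+1}$, be such that for $k\ge0$ it is a maximal $\delta^k$-separated subset of $X$, and for $k<0$ a maximal $\delta^k$-separated subset of $\mathscr X^{k+1}$ ($r$-separated: distinct points have quasi-distance $\ge r$). Each $(k+1,\beta)$ is given exactly one parent $(k,\alpha)$, written $(k+1,\beta)\le(k,\alpha)$, in such a way that $$d(x^{k+1}_\beta,x^k_\alpha)<\tfrac1{2A_0}\delta^k\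 \Rightarrow\ (k+1,\beta)\le(k,\alpha)\ \Rightarrow\ d(x^{k+1}_\beta,x^k_\alpha)<2A_0\delta^k .$$ *Labels.* Distinct $(k,\alpha),(k,\beta)$ are neighbours if they have children $(k+1,\gamma)\le(k,\alpha)$, $(k+1,\theta)\le(k,\beta)$ with $d(x^{k+1}_\gamma,x^{k+1}_\theta)<\frac{1}{2A_0}\delta^k$. Let $\mathrm{label}_1(k,\alpha)\in\{0,\dots,L\}$ differ for any two neighbours and $\mathrm{label}_2(k,\alpha)\in\{1,\dots,M\}$ differ for any two children of the same parent (for instance, $L$ is the maximal number of neighbours and $M$ the maximal number of children). *Random cubes.* Let $\Omega=(\{0,\dots,L\}\times\{1,\dots,M\})^{\mathbb Z}$, with the probability $\mathbb P_\omega$ making the coordinates $\omega_k=(\ell_k,m_k)$ independent and uniformly distributed. Set $z^k_\alpha(\omega)=x^{k+1}_\beta$ if $\mathrm{label}_1(k,\alpha)=\ell_k$ and $(k+1,\beta)\le(k,\alpha)$ with $\mathrm{label}_2(k+1,\beta)=m_k$, and $z^k_\alpha(\omega)=x^k_\alpha$ if $\mathrm{label}_1(k,\alpha)\neq\ell_k$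 or there is no such $\beta$. Let $(k+1,\beta)\le_\omega(k,\alpha)$ mean that either $d(x^{k+1}_\beta,z^k_\alpha)<\frac14A_0^{-2}\delta^k$, or $(k+1,\beta)\le(k,\alpha)$ and $d(x^{k+1}_\beta,z^k_\gamma)\ge\frac14A_0^{-2}\delta^k$ for all $\gamma$; extend $\le_\omega$ reflexively and transitively. Let $\bar Q^k_\alpha(\omega)$ be the closure of $\{z^\ell_\beta(\omega):(\ell,\beta)\le_\omega(k,\alpha)\}$. The spline functions are $$s^k_\alpha(x)=\mathbb P_\omega\big(x\in\bar Q^k_\alpha(\omega)\big).$$ **Theorem.** There are $\eta\in(0,1]$ and $C>0$, depending only on $A_0,\delta,L,M$, where $\eta=\log\!\big(1-\tfrac1{(L+1)M}\big)/\log\delta$ if $(L+1)M>1$, such that for every $X$, $d$ and choice of reference points, parents and labels as above, the events $\{\omega:x\in\bar Q^k_\alpha(\omega)\}$ are measurable and, for all $k\in\mathbb Z$, all $\alpha$ and all $x,y\in X$: 1. (bounded support) $1_{B(x^k_\alpha,\frac18A_0^{-3}\delta^k)}(x)\le s^k_\alpha(x)\le 1_{B(x^k_\alpha,8A_0^5\delta^k)}(x)$;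 2. (interpolation) $s^k_\alpha(x^k_\beta)=\delta_{\alpha\beta}$ for all $\beta$; 3. (partition of unity) $\sum_\alpha s^k_\alpha(x)=1$; 4. (refinement) $s^k_\alpha(x)=\sum_\beta p^k_{\alpha\beta}\,s^{k+1}_\beta(x)$, with coefficients $p^k_{\alpha\beta}\ge0$ independent of $x$, such that for each $\alpha$ only finitely many $p^k_{\alpha\beta}$ are nonzero, and $\sum_\alpha p^k_{\alpha\beta}=1$ for each $\beta$; 5. (Hölder continuity) $|s^k_\alpha(x)-s^k_\alpha(y)|\le C\big(d(x,y)/\delta^k\big)^\eta$. -/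

import Mathlib

namespace QuasiSpline

/-- `d` is a quasi-distance on `X` with quasi-triangle constant `A₀`. -/
structure IsQuasiDist {X : Type*} (d : X → X → ℝ) (A₀ : ℝ) : Prop where
  nonneg : ∀ x y, 0 ≤ d x y
  symm : ∀ x y, d x y = d y x
  eq_zero_iff : ∀ x y, d x y = 0 ↔ x = y
  triangle : ∀ x y z, d x y ≤ A₀ * (d x z + d z y)

/-- The ball `B(x, r) = {y : d(x, y) < r}`. -/
def qBall {X : Type*} (d : X → X → ℝ) (x : X) (r : ℝ) : Set X := {y | d x y < r}

/-- Geometric doubling: for some `N`, no ball contains more than `N` points whose mutual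
quasi-distances exceed half its radius. -/
def IsGeomDoubling {X : Type*} (d : X → X → ℝ) : Prop :=
  ∃ N : ℕ, ∀ (x : X) (r : ℝ), 0 < r → ∀ S : Finset X, (S : Set X) ⊆ qBall d x r →
    (S : Set X).Pairwise (fun y z => r / 2 < d y z) → S.card ≤ N

/-- A set is `r`-separated if distinct points of it have quasi-distance at least `r`. -/
def IsSep {X : Type*} (d : X → X → ℝ) (r : ℝ) (S : Set X) : Prop :=
  S.Pairwise (fun x y => r ≤ d x y)

/-- The topology of a quasi-distance: `U` is open if it contains a ball about each of its points. -/
def quasiTopology {X : Type*} (d : X → X → ℝ) : TopologicalSpace X where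
  IsOpen U := ∀ x ∈ U, ∃ r : ℝ, 0 < r ∧ qBall d x r ⊆ U
  isOpen_univ := fun _ _ => ⟨1, one_pos, Set.subset_univ _⟩
  isOpen_inter := by
    rintro U V hU hV x ⟨hxU, hxV⟩
    obtain ⟨r, hr, hrU⟩ := hU x hxU
    obtain ⟨s, hs, hsV⟩ := hV x hxV
    refine ⟨min r s, lt_min hr hs, fun y hy => ⟨hrU ?_, hsV ?_⟩⟩
    · exact lt_of_lt_of_le (show d x y < min r s from hy) (min_le_left _ _)
    · exact lt_of_lt_of_le (show d x y < min r s from hy) (min_le_right _ _)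
  isOpen_sUnion := by
    rintro 𝒰 h x ⟨U, hU, hx⟩
    obtain ⟨r, hr, hrU⟩ := h U hU x hx
    exact ⟨r, hr, fun y hy => ⟨U, hU, hrU hy⟩⟩

/-- The closure in the topology of a quasi-distance. -/
def qClosure {X : Type*} (d : X → X → ℝ) (S : Set X) : Set X := @closure X (quasiTopology d) S

theorem mem_qClosure_iff {X : Type*} {d : X → X → ℝ} {A₀ : ℝ} (hd : IsQuasiDist d A₀)
    (hA : 1 ≤ A₀) {S : Set X} {x : X} :
    x ∈ qClosure d S ↔ ∀ ε : ℝ, 0 < ε → ∃ y ∈ S, d x y < ε := by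
  let _ := quasiTopology d
  have hA0 : 0 < A₀ := by linarith
  have key : x ∈ qClosure d S ↔ ∀ U : Set X, IsOpen U → x ∈ U → (U ∩ S).Nonempty :=
    mem_closure_iff
  rw [key]
  constructor
  · intro h ε hε
    have hV : IsOpen {y | ∃ r : ℝ, 0 < r ∧ qBall d y r ⊆ qBall d x ε} := by
      rintro y ⟨r, hr, hsub⟩
      refine ⟨r / (2 * A₀), by positivity, fun z hz => ⟨r / (2 * A₀), by positivity, ?_⟩⟩
      intro w hw
      apply hsub
      have h1 : d y z < r / (2 * A₀) := hz
      have h2 : d z w < r / (2 * A₀) := hw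
      calc d y w ≤ A₀ * (d y z + d z w) := hd.triangle _ _ _
        _ < A₀ * (r / (2 * A₀) + r / (2 * A₀)) := by gcongr
        _ = r := by field_simp; ring
    obtain ⟨y, ⟨r, hr, hsub⟩, hyS⟩ := h _ hV ⟨ε, hε, subset_rfl⟩
    refine ⟨y, hyS, hsub ?_⟩
    show d y y < r
    rw [(hd.eq_zero_iff y y).2 rfl]
    exact hr
  · intro h U hU hx
    obtain ⟨r, hr, hsub⟩ := hU x hx
    obtain ⟨y, hyS, hy⟩ := h r hr
    exact ⟨y, hsub hy, hyS⟩

/-- A choice of the objects from which the random dyadic cubes are built. A pair `(k, α)` is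
represented by `k : ℤ` and the point `α = x^k_α ∈ pts k` itself. The functions `parent`, `label₁`,
`label₂` matter only at points of the relevant `pts k`. -/
structure DyadicData {X : Type*} (d : X → X → ℝ) (A₀ δ : ℝ) (L M : ℕ) where
  /-- The reference dyadic points of generation `k`. -/
  pts : ℤ → Set X
  pts_subset : ∀ k, pts k ⊆ pts (k + 1)
  /-- For `k ≥ 0`, the points form a maximal `δ^k`-separated set in `X`. -/
  maximal_of_nonneg : ∀ k : ℤ, 0 ≤ k → Maximal (fun S => IsSep d (δ ^ k) S) (pts k)
  /-- For `k < 0`, they form a maximal `δ^k`-separated set in the points of generation `k + 1`. -/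
  maximal_of_neg : ∀ k : ℤ, k < 0 →
    Maximal (fun S => S ⊆ pts (k + 1) ∧ IsSep d (δ ^ k) S) (pts k)
  /-- `parent k β` is the unique `α` with `(k + 1, β) ≤ (k, α)`. -/
  parent : ℤ → X → X
  parent_mem : ∀ k, ∀ β ∈ pts (k + 1), parent k β ∈ pts k
  parent_eq_of_lt : ∀ k, ∀ β ∈ pts (k + 1), ∀ α ∈ pts k,
    d β α < δ ^ k / (2 * A₀) → parent k β = α
  dist_parent_lt : ∀ k, ∀ β ∈ pts (k + 1), d β (parent k β) < 2 * A₀ * δ ^ k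
  /-- The primary labels, in `{0, …, L}`. -/
  label₁ : ℤ → X → Fin (L + 1)
  /-- Neighbours, that is, distinct `(k, α)`, `(k, β)` which have children at quasi-distance less
  than `δ^k / (2 A₀)`, have different primary labels. -/
  label₁_ne : ∀ k, ∀ α ∈ pts k, ∀ β ∈ pts k, α ≠ β →
    (∃ γ ∈ pts (k + 1), ∃ θ ∈ pts (k + 1),
      parent k γ = α ∧ parent k θ = β ∧ d γ θ < δ ^ k / (2 * A₀)) →
    label₁ k α ≠ label₁ k β
  /-- The secondary labels, from a set with `M` elements. -/
  label₂ : ℤ → X → Fin M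
  /-- Distinct children of the same parent have different secondary labels. -/
  label₂_ne : ∀ k, ∀ β ∈ pts (k + 1), ∀ γ ∈ pts (k + 1), β ≠ γ →
    parent k β = parent k γ → label₂ (k + 1) β ≠ label₂ (k + 1) γ

/-- The parameter space `Ω = ({0, …, L} × {1, …, M})^ℤ`. -/
abbrev Param (L M : ℕ) : Type := ℤ → Fin (L + 1) × Fin M

/-- The probability measure on `Ω` which makes the coordinates independent and uniform. -/
noncomputable def paramProb (L M : ℕ) [NeZero M] : MeasureTheory.Measure (Param L M) :=
  MeasureTheory.Measure.infinitePi
    (fun _ : ℤ => (PMF.uniformOfFintype (Fin (L + 1) × Fin M)).toMeasure)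

namespace DyadicData

variable {X : Type*} {d : X → X → ℝ} {A₀ δ : ℝ} {L M : ℕ}

/-- `(k + 1, β) ≤ (k, α)`, i.e. `(k + 1, β)` is a child of `(k, α)`. -/
def IsChild (D : DyadicData d A₀ δ L M) (k : ℤ) (β α : X) : Prop :=
  β ∈ D.pts (k + 1) ∧ D.parent k β = α

open Classical in
/-- The new dyadic point `z^k_α`, as a function of the coordinate `c = ω_k`. -/
noncomputable def newPoint (D : DyadicData d A₀ δ L M) (c : Fin (L + 1) × Fin M)
    (k : ℤ) (α : X) : X :=
  if h : D.label₁ k α = c.1 ∧ ∃ β, D.IsChild k β α ∧ D.label₂ (k + 1) β = c.2 then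
    Classical.choose h.2
  else α

/-- `(k + 1, β) ≤_ω (k, α)`, as a relation that depends on the coordinate `c = ω_k`. -/
def IsNewChild (D : DyadicData d A₀ δ L M) (c : Fin (L + 1) × Fin M)
    (k : ℤ) (β α : X) : Prop :=
  β ∈ D.pts (k + 1) ∧ α ∈ D.pts k ∧
    (d β (D.newPoint c k α) < δ ^ k / (4 * A₀ ^ 2) ∨
      (D.IsChild k β α ∧ ¬ ∃ γ ∈ D.pts k, d β (D.newPoint c k γ) < δ ^ k / (4 * A₀ ^ 2)))

/-- The new partial order `(ℓ, β) ≤_ω (k, α)`: the reflexive and transitive closure of the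
relation between consecutive generations. -/
def NewLE (D : DyadicData d A₀ δ L M) (ω : Param L M) : ℤ × X → ℤ × X → Prop :=
  Relation.ReflTransGen (fun p q => p.1 = q.1 + 1 ∧ D.IsNewChild (ω q.1) q.1 p.2 q.2)

/-- The preliminary cube, i.e. the set of all `z^ℓ_β(ω)` with `(ℓ, β) ≤_ω (k, α)`. -/
def preCube (D : DyadicData d A₀ δ L M) (ω : Param L M) (k : ℤ) (α : X) : Set X :=
  {x | ∃ (ℓ : ℤ) (β : X), β ∈ D.pts ℓ ∧ D.NewLE ω (ℓ, β) (k, α) ∧ x = D.newPoint (ω ℓ) ℓ β}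

/-- The closed dyadic cube. -/
def closedCube (D : DyadicData d A₀ δ L M) (ω : Param L M) (k : ℤ) (α : X) : Set X :=
  qClosure d (D.preCube ω k α)

/-- The spline `s^k_α(x)`: the probability that `x` lies in the random closed cube. -/
noncomputable def spline [NeZero M] (D : DyadicData d A₀ δ L M) (k : ℤ) (α x : X) : ℝ :=
  (paramProb L M).real {ω | x ∈ D.closedCube ω k α}

end DyadicData

end QuasiSpline

namespace QuasiSpline

/-! For fixed `ω` the new points of generation `k` are `δ ^ k / (2 * A₀)`-separated, so each
reference point of generation `k + 1` has exactly one new parent. Distances along chains of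
ancestors form geometric sums dominated by the coarsest term; hence closed cubes have size
comparable to `δ ^ k`, cover the space, and are finite unions of the closed cubes of their new
children (`mem_closedCube_iff`). Bounded support follows without any probability.

Closed cubes may overlap, and randomness makes this negligible. Given `x` and `k`, some value of `ω
k` moves a new point of generation `k` close to `x`; since `δ` is small, all cubes of generation `k
+ 1` that come within `δ ^ (k + 1)` of `x` then become children of one cube (`exists_coord`).
Uniqueness persists in all coarser generations. If `d x y ≤ δ ^ (k + m)`, the points `x, y` can thus
fail to share a unique cube of generation `k` only if `m` independent coordinates all miss their
good value, which has probability `(1 - 1 / ((L + 1) * M)) ^ m` (`exists_compl_prob_le`).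

With `y = x` and `m → ∞`, distinct cubes are almost surely disjoint at `x`, which gives the
partition of unity and interpolation. With general `y` the bound is the Hölder estimate. Refinement
holds because new parenthood depends on `ω k` alone and the cubes of generation `k + 1` on later
coordinates only, so the probabilities multiply. -/

/-- The standing assumptions on the space and on the parameters. -/
structure IsAdmissible {X : Type*} (d : X → X → ℝ) (A₀ δ : ℝ) : Prop where
  quasi : IsQuasiDist d A₀
  doubling : IsGeomDoubling d
  one_le : 1 ≤ A₀
  pos : 0 < δ
  le : δ ≤ 1 / (1000 * A₀ ^ 10)

/-! ### Quasi-triangle inequality and local finiteness of separated sets -/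

theorem IsQuasiDist.self {X : Type*} {d : X → X → ℝ} {A₀ : ℝ} (hd : IsQuasiDist d A₀) (x : X) :
    d x x = 0 := (hd.eq_zero_iff x x).2 rfl

/-- The quasi-triangle inequality with upper bounds for the two distances. -/
theorem IsQuasiDist.triangle_le {X : Type*} {d : X → X → ℝ} {A₀ : ℝ} (hd : IsQuasiDist d A₀)
    (hA : 1 ≤ A₀) {x y z : X} {a b : ℝ} (h₁ : d x y ≤ a) (h₂ : d y z ≤ b) :
    d x z ≤ A₀ * (a + b) := by
  refine (hd.triangle x z y).trans ?_
  gcongr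

theorem IsQuasiDist.triangle_lt {X : Type*} {d : X → X → ℝ} {A₀ : ℝ} (hd : IsQuasiDist d A₀)
    (hA : 1 ≤ A₀) {x y z : X} {a b : ℝ} (h₁ : d x y < a) (h₂ : d y z ≤ b) :
    d x z < A₀ * (a + b) := by
  refine (hd.triangle x z y).trans_lt ?_
  have : 0 < A₀ := by linarith
  exact mul_lt_mul_of_pos_left (by linarith) this

/-- Doubling covers a ball by finitely many smaller ones; iterating until the radius is at most `ε /
(2 * A₀)` leaves at most one point of `S` in each. -/
theorem IsGeomDoubling.finite_of_isSep {X : Type*} {d : X → X → ℝ} {A₀ : ℝ}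
    (h : IsGeomDoubling d) (hd : IsQuasiDist d A₀) (hA : 1 ≤ A₀) {ε : ℝ} (hε : 0 < ε)
    {S : Set X} (hS : IsSep d ε S) {x : X} {r : ℝ} (hSr : S ⊆ qBall d x r) : S.Finite := by
  classical
  obtain ⟨N, hN⟩ := h
  have hA0 : 0 < A₀ := by linarith
  have key : ∀ n : ℕ, ∀ r : ℝ, (3 / 4 : ℝ) ^ n * r ≤ ε / (2 * A₀) → ∀ (x : X) (S : Set X),
      IsSep d ε S → S ⊆ qBall d x r → S.Finite := by
    intro n
    induction n with
    | zero =>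
      intro r hr x S hS hSr
      refine Set.Subsingleton.finite fun y hy z hz => ?_
      by_contra hyz
      have h1 : d x y < r := hSr hy
      have h2 : d x z < r := hSr hz
      have h3 := hS hy hz hyz
      have h4 := hd.triangle_lt hA (hd.symm y x ▸ h1) h2.le
      have h5 : A₀ * (r + r) ≤ A₀ * (ε / (2 * A₀) + ε / (2 * A₀)) := by
        have : r ≤ ε / (2 * A₀) := by simpa using hr
        gcongr
      have h6 : A₀ * (ε / (2 * A₀) + ε / (2 * A₀)) = ε := by field_simp; norm_num
      linarith
    | succ n ih =>
      intro r hr x S hS hSr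
      rcases le_or_gt r 0 with hr0 | hr0
      · convert Set.finite_empty
        refine Set.eq_empty_of_forall_notMem fun y hy => ?_
        have h1 : d x y < r := hSr hy
        linarith [hd.nonneg x y]
      by_contra hinf
      have hT : ∀ m : ℕ, ∃ T : Finset X, (T : Set X) ⊆ S ∧
          (T : Set X).Pairwise (fun y z => r / 2 < d y z) ∧ T.card = m := by
        intro m
        induction m with
        | zero => exact ⟨∅, by simp, by simp, rfl⟩
        | succ m ihm =>
          obtain ⟨T, hTS, hTp, hTc⟩ := ihm
          -- Points not farther than `r / 2` from `t` need not lie in the open ball of radius `r /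
          -- 2`, so the radius shrinks by `3 / 4` instead.
          have hfin : (⋃ t ∈ T, S ∩ qBall d t (3 / 4 * r)).Finite := by
            refine Set.Finite.biUnion T.finite_toSet fun t _ => ?_
            refine ih (3 / 4 * r) ?_ t _ (hS.mono Set.inter_subset_left) Set.inter_subset_right
            rwa [← mul_assoc, ← pow_succ]
          obtain ⟨s, hs, hsT⟩ := Set.Infinite.exists_notMem_finite hinf hfin
          have hfar : ∀ t ∈ T, r / 2 < d t s := by
            intro t ht
            by_contra hlt
            refine hsT (Set.mem_biUnion (show t ∈ (T : Set X) from ht) ⟨hs, ?_⟩)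
            show d t s < 3 / 4 * r
            linarith
          have hsT' : s ∉ T := fun hmem => by
            have := hfar s hmem
            rw [hd.self] at this
            linarith
          refine ⟨insert s T, ?_, ?_, ?_⟩
          · rw [Finset.coe_insert]
            exact Set.insert_subset hs hTS
          · rw [Finset.coe_insert]
            refine hTp.insert fun t ht _ => ⟨?_, hfar t ht⟩
            rw [hd.symm]
            exact hfar t ht
          · rw [Finset.card_insert_of_notMem hsT', hTc]
      obtain ⟨T, hTS, hTp, hTc⟩ := hT (N + 1)
      have := hN x r hr0 T (hTS.trans hSr) hTp
      omega
  rcases le_or_gt r 0 with hr0 | hr0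
  · exact key 0 r (by simpa using hr0.trans (by positivity)) x S hS hSr
  obtain ⟨n, hn⟩ := exists_pow_lt_of_lt_one (show 0 < ε / (2 * A₀) / r by positivity)
    (show (3 / 4 : ℝ) < 1 by norm_num)
  exact key n r ((lt_div_iff₀ hr0).1 hn).le x S hS hSr

namespace IsAdmissible

variable {X : Type*} {d : X → X → ℝ} {A₀ δ : ℝ}

theorem mul_pow_le (h : IsAdmissible d A₀ δ) {n : ℕ} (hn : n ≤ 10) : δ * A₀ ^ n ≤ 1 / 1000 := by
  have hA := h.one_le
  have h0 : 0 < A₀ := by linarith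
  calc δ * A₀ ^ n ≤ δ * A₀ ^ 10 := by have := h.pos; gcongr
    _ ≤ 1 / (1000 * A₀ ^ 10) * A₀ ^ 10 := by gcongr; exact h.le
    _ = 1 / 1000 := by field_simp

theorem lt_one (h : IsAdmissible d A₀ δ) : δ < 1 := by
  have := h.mul_pow_le (n := 0) (by norm_num)
  linarith

theorem zpow_pos (h : IsAdmissible d A₀ δ) (k : ℤ) : 0 < δ ^ k := _root_.zpow_pos h.pos k

theorem zpow_succ (h : IsAdmissible d A₀ δ) (k : ℤ) : δ ^ (k + 1) = δ ^ k * δ :=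
  zpow_add_one₀ h.pos.ne' k

theorem zpow_le_zpow (h : IsAdmissible d A₀ δ) {k l : ℤ} (hkl : k ≤ l) : δ ^ l ≤ δ ^ k :=
  zpow_le_zpow_right_of_le_one₀ h.pos h.lt_one.le hkl

end IsAdmissible

namespace DyadicData

variable {X : Type*} {d : X → X → ℝ} {A₀ δ : ℝ} {L M : ℕ}

/-! ### Reference points: density and local finiteness -/

theorem isSep_pts (D : DyadicData d A₀ δ L M) (k : ℤ) : IsSep d (δ ^ k) (D.pts k) := by
  rcases le_or_gt 0 k with hk | hk
  · exact (D.maximal_of_nonneg k hk).prop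
  · exact (D.maximal_of_neg k hk).prop.2

theorem exists_dist_lt_of_maximal (h : IsAdmissible d A₀ δ) {r : ℝ} (hr : 0 < r) {S T : Set X}
    (hS : Maximal (fun S => S ⊆ T ∧ IsSep d r S) S) {x : X} (hx : x ∈ T) :
    ∃ p ∈ S, d x p < r := by
  by_contra! hfar
  have hle : insert x S ⊆ S := by
    refine hS.le_of_ge ⟨Set.insert_subset hx hS.prop.1, ?_⟩ (Set.subset_insert x S)
    refine hS.prop.2.insert fun p hp _ => ⟨hfar p hp, ?_⟩
    rw [h.quasi.symm]
    exact hfar p hp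
  have := hfar x (hle (Set.mem_insert x S))
  rw [h.quasi.self] at this
  linarith

theorem exists_pts_dist_lt (h : IsAdmissible d A₀ δ) (D : DyadicData d A₀ δ L M) (k : ℤ) (x : X) :
    ∃ p ∈ D.pts k, d x p < 2 * A₀ * δ ^ k := by
  have hA := h.one_le
  have hnonneg : ∀ k : ℤ, 0 ≤ k → ∃ p ∈ D.pts k, d x p < 2 * A₀ * δ ^ k := by
    intro k hk
    have hmax : Maximal (fun S => S ⊆ Set.univ ∧ IsSep d (δ ^ k) S) (D.pts k) := by
      simpa using D.maximal_of_nonneg k hk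
    obtain ⟨p, hp, hlt⟩ := exists_dist_lt_of_maximal h (h.zpow_pos k) hmax (Set.mem_univ x)
    refine ⟨p, hp, hlt.trans_le ?_⟩
    nlinarith [h.zpow_pos k]
  rcases le_or_gt 0 k with hk | hk
  · exact hnonneg k hk
  -- Negative generations are maximal only inside the next one, so errors accumulate; the constant
  -- `2 * A₀` reproduces itself because `2 * δ * A₀ + 1 ≤ 2`.
  have hneg : ∀ n : ℕ, ∃ p ∈ D.pts (-(n : ℤ)), d x p < 2 * A₀ * δ ^ (-(n : ℤ)) := by
    intro n
    induction n with
    | zero => exact hnonneg _ (by simp)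
    | succ n ih =>
      obtain ⟨p, hp, hlt⟩ := ih
      have hn : -((n + 1 : ℕ) : ℤ) + 1 = -(n : ℤ) := by push_cast; ring
      rw [← hn] at hp hlt
      have hmax := D.maximal_of_neg (-((n + 1 : ℕ) : ℤ)) (by push_cast; omega)
      have hpos := h.zpow_pos (-((n + 1 : ℕ) : ℤ))
      rw [h.zpow_succ] at hlt
      obtain ⟨q, hq, hpq⟩ := exists_dist_lt_of_maximal h hpos hmax hp
      refine ⟨q, hq, (h.quasi.triangle_lt hA hlt hpq.le).trans_le ?_⟩
      have h2 := h.mul_pow_le (n := 1) (by norm_num)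
      generalize δ ^ (-((n + 1 : ℕ) : ℤ)) = u at *
      have : A₀ * (2 * A₀ * (u * δ) + u) = A₀ * u * (2 * (δ * A₀ ^ 1) + 1) := by ring
      rw [this]
      have : 0 < A₀ * u := by positivity
      nlinarith
  have := hneg k.natAbs
  rwa [show -(k.natAbs : ℤ) = k by omega] at this

theorem finite_pts_inter (h : IsAdmissible d A₀ δ) (D : DyadicData d A₀ δ L M) (k : ℤ) (x : X)
    (r : ℝ) : (D.pts k ∩ qBall d x r).Finite :=
  h.doubling.finite_of_isSep h.quasi h.one_le (h.zpow_pos k)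
    ((D.isSep_pts k).mono Set.inter_subset_left) Set.inter_subset_right

theorem countable_pts (h : IsAdmissible d A₀ δ) (D : DyadicData d A₀ δ L M) (k : ℤ) :
    (D.pts k).Countable := by
  rcases isEmpty_or_nonempty X with hX | ⟨⟨x⟩⟩
  · exact Set.Subsingleton.countable fun y => (hX.false y).elim
  have : D.pts k = ⋃ n : ℕ, D.pts k ∩ qBall d x n := by
    rw [← Set.inter_iUnion, eq_comm, Set.inter_eq_left]
    intro y _
    obtain ⟨n, hn⟩ := exists_nat_gt (d x y)
    exact Set.mem_iUnion.2 ⟨n, hn⟩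
  rw [this]
  exact Set.countable_iUnion fun n => (D.finite_pts_inter h k x n).countable

theorem parent_self (h : IsAdmissible d A₀ δ) (D : DyadicData d A₀ δ L M) {k : ℤ} {α : X}
    (hα : α ∈ D.pts k) : D.parent k α = α := by
  refine D.parent_eq_of_lt k α (D.pts_subset k hα) α hα ?_
  have := h.zpow_pos k
  have := h.one_le
  rw [h.quasi.self]
  positivity

/-! ### New points and new parents -/

theorem isChild_newPoint (h : IsAdmissible d A₀ δ) (D : DyadicData d A₀ δ L M)
    (c : Fin (L + 1) × Fin M) {k : ℤ} {α : X} (hα : α ∈ D.pts k) :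
    D.IsChild k (D.newPoint c k α) α := by
  unfold newPoint
  split_ifs with hc
  · exact (Classical.choose_spec hc.2).1
  · exact ⟨D.pts_subset k hα, D.parent_self h hα⟩

theorem newPoint_eq_or (D : DyadicData d A₀ δ L M) (c : Fin (L + 1) × Fin M) (k : ℤ) (α : X) :
    D.newPoint c k α = α ∨ D.label₁ k α = c.1 := by
  unfold newPoint
  split_ifs with hc
  · exact Or.inr hc.1
  · exact Or.inl rfl

/-- Secondary labels are injective on the children of `α`, so the choice in `newPoint` is forced.
This lets a coordinate steer the new point to any prescribed child. -/
theorem newPoint_label (D : DyadicData d A₀ δ L M) {k : ℤ} {α β : X} (hβ : D.IsChild k β α) :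
    D.newPoint (D.label₁ k α, D.label₂ (k + 1) β) k α = β := by
  have hc : D.label₁ k α = (D.label₁ k α, D.label₂ (k + 1) β).1 ∧
      ∃ γ, D.IsChild k γ α ∧ D.label₂ (k + 1) γ = (D.label₁ k α, D.label₂ (k + 1) β).2 :=
    ⟨rfl, β, hβ, rfl⟩
  unfold newPoint
  rw [dif_pos hc]
  obtain ⟨h1, h2⟩ := Classical.choose_spec hc.2
  by_contra hne
  exact D.label₂_ne k _ h1.1 β hβ.1 hne (h1.2.trans hβ.2.symm) h2

theorem dist_newPoint_lt (h : IsAdmissible d A₀ δ) (D : DyadicData d A₀ δ L M)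
    (c : Fin (L + 1) × Fin M) {k : ℤ} {α : X} (hα : α ∈ D.pts k) :
    d (D.newPoint c k α) α < 2 * A₀ * δ ^ k := by
  obtain ⟨h1, h2⟩ := D.isChild_newPoint h c hα
  have := D.dist_parent_lt k _ h1
  rwa [h2] at this

/-- A reference point is far from the new points that belong to other reference points. -/
theorem le_dist_newPoint (h : IsAdmissible d A₀ δ) (D : DyadicData d A₀ δ L M)
    (c : Fin (L + 1) × Fin M) {k : ℤ} {α γ : X} (hα : α ∈ D.pts k) (hγ : γ ∈ D.pts k)
    (hne : α ≠ γ) : δ ^ k / (2 * A₀) ≤ d α (D.newPoint c k γ) := by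
  by_contra! hlt
  rw [h.quasi.symm] at hlt
  obtain ⟨h1, h2⟩ := D.isChild_newPoint h c hγ
  exact hne ((D.parent_eq_of_lt k _ h1 α hα hlt).symm.trans h2)

/-- If one of the two points has not moved, `le_dist_newPoint` applies. If both may have moved,
their primary labels agree, so `α` and `γ` are not neighbours. -/
theorem le_dist_newPoint_newPoint (h : IsAdmissible d A₀ δ) (D : DyadicData d A₀ δ L M)
    (c : Fin (L + 1) × Fin M) {k : ℤ} {α γ : X} (hα : α ∈ D.pts k) (hγ : γ ∈ D.pts k)
    (hne : α ≠ γ) : δ ^ k / (2 * A₀) ≤ d (D.newPoint c k α) (D.newPoint c k γ) := by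
  rcases D.newPoint_eq_or c k α with h1 | h1
  · rw [h1]
    exact D.le_dist_newPoint h c hα hγ hne
  rcases D.newPoint_eq_or c k γ with h2 | h2
  · rw [h2, h.quasi.symm]
    exact D.le_dist_newPoint h c hγ hα hne.symm
  by_contra! hlt
  obtain ⟨h3, h4⟩ := D.isChild_newPoint h c hα
  obtain ⟨h5, h6⟩ := D.isChild_newPoint h c hγ
  exact D.label₁_ne k α hα γ hγ hne ⟨_, h3, _, h5, h4, h6, hlt⟩ (h1.trans h2.symm)

theorem eq_of_dist_newPoint_lt (h : IsAdmissible d A₀ δ) (D : DyadicData d A₀ δ L M)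
    (c : Fin (L + 1) × Fin M) {k : ℤ} {α γ β : X} (hα : α ∈ D.pts k) (hγ : γ ∈ D.pts k)
    (h1 : d β (D.newPoint c k α) < δ ^ k / (4 * A₀ ^ 2))
    (h2 : d β (D.newPoint c k γ) < δ ^ k / (4 * A₀ ^ 2)) : α = γ := by
  by_contra hne
  have h3 := D.le_dist_newPoint_newPoint h c hα hγ hne
  rw [h.quasi.symm] at h1
  have h4 := h.quasi.triangle_lt h.one_le h1 h2.le
  have hA := h.one_le
  have : A₀ * (δ ^ k / (4 * A₀ ^ 2) + δ ^ k / (4 * A₀ ^ 2)) = δ ^ k / (2 * A₀) := by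
    field_simp; ring
  linarith

theorem exists_isNewChild (D : DyadicData d A₀ δ L M)
    (c : Fin (L + 1) × Fin M) {k : ℤ} {β : X} (hβ : β ∈ D.pts (k + 1)) :
    ∃ α, D.IsNewChild c k β α := by
  by_cases hγ : ∃ γ ∈ D.pts k, d β (D.newPoint c k γ) < δ ^ k / (4 * A₀ ^ 2)
  · obtain ⟨γ, hγ, hlt⟩ := hγ
    exact ⟨γ, hβ, hγ, Or.inl hlt⟩
  · exact ⟨D.parent k β, hβ, D.parent_mem k β hβ, Or.inr ⟨⟨hβ, rfl⟩, hγ⟩⟩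

theorem IsNewChild.unique (h : IsAdmissible d A₀ δ) {D : DyadicData d A₀ δ L M}
    {c : Fin (L + 1) × Fin M} {k : ℤ} {β α γ : X} (h1 : D.IsNewChild c k β α)
    (h2 : D.IsNewChild c k β γ) : α = γ := by
  obtain ⟨_, hα, h1 | ⟨h1, h1'⟩⟩ := h1 <;> obtain ⟨_, hγ, h2 | ⟨h2, h2'⟩⟩ := h2
  · exact D.eq_of_dist_newPoint_lt h c hα hγ h1 h2
  · exact absurd ⟨α, hα, h1⟩ h2'
  · exact absurd ⟨γ, hγ, h2⟩ h1'
  · exact h1.2.symm.trans h2.2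

/-- A competing new point close to `β` would be too close to `α`; without one, the old parent `α` is
kept. -/
theorem isNewChild_of_dist_lt (h : IsAdmissible d A₀ δ) (D : DyadicData d A₀ δ L M)
    (c : Fin (L + 1) × Fin M) {k : ℤ} {β α : X} (hβ : β ∈ D.pts (k + 1)) (hα : α ∈ D.pts k)
    (hlt : d β α < δ ^ k / (4 * A₀ ^ 2)) : D.IsNewChild c k β α := by
  refine ⟨hβ, hα, ?_⟩
  have hA := h.one_le
  have hu := h.zpow_pos k
  by_cases hex : ∃ γ ∈ D.pts k, d β (D.newPoint c k γ) < δ ^ k / (4 * A₀ ^ 2)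
  · obtain ⟨γ, hγ, h1⟩ := hex
    by_cases hαγ : α = γ
    · exact Or.inl (hαγ ▸ h1)
    · have h2 := D.le_dist_newPoint h c hα hγ hαγ
      rw [h.quasi.symm] at hlt
      have h4 := h.quasi.triangle_lt h.one_le hlt h1.le
      have : A₀ * (δ ^ k / (4 * A₀ ^ 2) + δ ^ k / (4 * A₀ ^ 2)) = δ ^ k / (2 * A₀) := by
        field_simp; ring
      linarith
  · refine Or.inr ⟨⟨hβ, D.parent_eq_of_lt k β hβ α hα (hlt.trans_le ?_)⟩, hex⟩
    gcongr δ ^ k / ?_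
    nlinarith

theorem IsNewChild.dist_le (h : IsAdmissible d A₀ δ) {D : DyadicData d A₀ δ L M}
    {c : Fin (L + 1) × Fin M} {k : ℤ} {β α : X} (hβ : D.IsNewChild c k β α) :
    d β α ≤ 9 / 4 * A₀ ^ 2 * δ ^ k := by
  have hA := h.one_le
  have hu := h.zpow_pos k
  obtain ⟨hβ, hα, h1 | ⟨h1, -⟩⟩ := hβ
  · refine (h.quasi.triangle_le hA h1.le (D.dist_newPoint_lt h c hα).le).trans ?_
    have h2 : δ ^ k / (4 * A₀ ^ 2) ≤ δ ^ k / 4 := by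
      gcongr
      nlinarith
    calc A₀ * (δ ^ k / (4 * A₀ ^ 2) + 2 * A₀ * δ ^ k)
        ≤ A₀ * (δ ^ k / 4 * A₀ + 2 * A₀ * δ ^ k) := by
          gcongr
          exact h2.trans (le_mul_of_one_le_right (by positivity) hA)
      _ = 9 / 4 * A₀ ^ 2 * δ ^ k := by ring
  · have := D.dist_parent_lt k β hβ
    rw [h1.2] at this
    refine this.le.trans ?_
    gcongr
    · norm_num
    · exact le_self_pow₀ hA two_ne_zero

theorem finite_setOf_isNewChild (h : IsAdmissible d A₀ δ) (D : DyadicData d A₀ δ L M)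
    (k : ℤ) (α : X) : {β | ∃ c, D.IsNewChild c k β α}.Finite := by
  refine (D.finite_pts_inter h (k + 1) α (9 / 4 * A₀ ^ 2 * δ ^ k + 1)).subset ?_
  rintro β ⟨c, hβ⟩
  refine ⟨hβ.1, ?_⟩
  show d α β < _
  rw [h.quasi.symm]
  linarith [hβ.dist_le h]

/-! ### Geometry of the closed cubes for a fixed parameter -/

/-- The constant absorbs a further step: the error inherited from generation `q.1 + 1` carries a
factor `δ`, and `3 * δ * A₀ + 9 / 4 ≤ 3`. -/
theorem NewLE.bound (h : IsAdmissible d A₀ δ) {D : DyadicData d A₀ δ L M} {ω : Param L M}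
    {p q : ℤ × X} (hpq : D.NewLE ω p q) (hp : p.2 ∈ D.pts p.1) :
    q.1 ≤ p.1 ∧ q.2 ∈ D.pts q.1 ∧ d p.2 q.2 ≤ 3 * A₀ ^ 3 * δ ^ q.1 := by
  have hA := h.one_le
  induction hpq with
  | refl =>
    refine ⟨le_rfl, hp, ?_⟩
    have := h.zpow_pos p.1
    rw [h.quasi.self]
    positivity
  | @tail r q _ hrq ih =>
    obtain ⟨h1, hc⟩ := hrq
    obtain ⟨h2, -, h3⟩ := ih
    refine ⟨by omega, hc.2.1, (h.quasi.triangle_le hA h3 (hc.dist_le h)).trans ?_⟩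
    rw [h1, h.zpow_succ]
    have hu := h.zpow_pos q.1
    have h4 := h.mul_pow_le (n := 1) (by norm_num)
    calc A₀ * (3 * A₀ ^ 3 * (δ ^ q.1 * δ) + 9 / 4 * A₀ ^ 2 * δ ^ q.1)
        = A₀ ^ 3 * δ ^ q.1 * (3 * (δ * A₀ ^ 1) + 9 / 4) := by ring
      _ ≤ A₀ ^ 3 * δ ^ q.1 * 3 := by gcongr; linarith
      _ = 3 * A₀ ^ 3 * δ ^ q.1 := by ring

theorem exists_newLE (D : DyadicData d A₀ δ L M) (ω : Param L M) (k : ℤ) (n : ℕ) {β : X}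
    (hβ : β ∈ D.pts (k + n)) : ∃ α ∈ D.pts k, D.NewLE ω (k + n, β) (k, α) := by
  induction n generalizing β with
  | zero => exact ⟨β, by simpa using hβ, by simp only [Nat.cast_zero, add_zero]; exact .refl⟩
  | succ n ih =>
    have hn : k + ((n + 1 : ℕ) : ℤ) = k + n + 1 := by push_cast; ring
    rw [hn] at hβ ⊢
    obtain ⟨γ, hγ⟩ := D.exists_isNewChild (ω (k + n)) hβ
    obtain ⟨α, hα, hle⟩ := ih hγ.2.1
    exact ⟨α, hα, Relation.ReflTransGen.head ⟨rfl, hγ⟩ hle⟩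

theorem dist_lt_of_mem_closedCube (h : IsAdmissible d A₀ δ) {D : DyadicData d A₀ δ L M}
    {ω : Param L M} {k : ℤ} {α x : X} (hx : x ∈ D.closedCube ω k α) :
    d α x < 8 * A₀ ^ 5 * δ ^ k := by
  have hA := h.one_le
  have hu := h.zpow_pos k
  obtain ⟨y, ⟨ℓ, β, hβ, hle, rfl⟩, hxy⟩ :=
    (mem_qClosure_iff h.quasi h.one_le).1 hx (A₀ ^ 4 * δ ^ k) (by positivity)
  obtain ⟨h1, -, h2⟩ := hle.bound h hβ
  have h3 := (D.dist_newPoint_lt h (ω ℓ) hβ).le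
  have h4 := h.quasi.triangle_le hA h3 h2
  have h5 := h.quasi.triangle_le hA hxy.le h4
  rw [h.quasi.symm]
  refine h5.trans_lt ?_
  have h6 := h.zpow_le_zpow h1
  calc A₀ * (A₀ ^ 4 * δ ^ k + A₀ * (2 * A₀ * δ ^ ℓ + 3 * A₀ ^ 3 * δ ^ k))
      ≤ A₀ * (A₀ ^ 4 * δ ^ k + A₀ * (2 * A₀ ^ 3 * δ ^ k + 3 * A₀ ^ 3 * δ ^ k)) := by
        have := (h.zpow_pos ℓ).le
        gcongr
        exact le_self_pow₀ hA three_ne_zero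
    _ = 6 * A₀ ^ 5 * δ ^ k := by ring
    _ < 8 * A₀ ^ 5 * δ ^ k := by
        have : 0 < A₀ ^ 5 * δ ^ k := by positivity
        linarith

theorem mem_pts_of_mem_closedCube (h : IsAdmissible d A₀ δ) {D : DyadicData d A₀ δ L M}
    {ω : Param L M} {k : ℤ} {α x : X} (hx : x ∈ D.closedCube ω k α) : α ∈ D.pts k := by
  obtain ⟨y, ⟨ℓ, β, hβ, hle, rfl⟩, -⟩ :=
    (mem_qClosure_iff h.quasi h.one_le).1 hx 1 one_pos
  exact (hle.bound h hβ).2.1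

/-- The closed cubes of each generation cover the space. -/
theorem exists_mem_closedCube (h : IsAdmissible d A₀ δ) (D : DyadicData d A₀ δ L M)
    (ω : Param L M) (k : ℤ) (x : X) : ∃ α ∈ D.pts k, x ∈ D.closedCube ω k α := by
  have hA := h.one_le
  -- Ever finer reference points approach `x`; their ancestors of generation `k` stay in a finite
  -- set, so one ancestor occurs infinitely often.
  choose β hβ hxβ using fun n : ℕ => D.exists_pts_dist_lt h (k + n) x
  choose α hα hle using fun n : ℕ => D.exists_newLE ω k n (hβ n)
  have hfin := D.finite_pts_inter h k x (A₀ * (2 * A₀ * δ ^ k + 3 * A₀ ^ 3 * δ ^ k))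
  have hmem : ∀ n, α n ∈ D.pts k ∩ qBall d x (A₀ * (2 * A₀ * δ ^ k + 3 * A₀ ^ 3 * δ ^ k)) := by
    intro n
    refine ⟨hα n, h.quasi.triangle_lt hA ((hxβ n).trans_le ?_) ((hle n).bound h (hβ n)).2.2⟩
    have := h.zpow_le_zpow (Int.le_add_of_nonneg_right (Int.natCast_nonneg n) : k ≤ k + n)
    gcongr
  have := hfin.to_subtype
  obtain ⟨⟨a, ha, ha'⟩, hinf⟩ := Finite.exists_infinite_fiber (Set.codRestrict α _ hmem)
  refine ⟨a, ha, (mem_qClosure_iff h.quasi hA).2 fun ε hε => ?_⟩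
  have hu := h.zpow_pos k
  obtain ⟨m, hm⟩ := exists_pow_lt_of_lt_one (show 0 < ε / (A₀ * (2 * A₀ + 2 * A₀) * δ ^ k) by
    positivity) h.lt_one
  obtain ⟨n, hn, hmn⟩ := (Set.infinite_coe_iff.1 hinf).exists_gt m
  have hαn : α n = a := congrArg Subtype.val hn
  refine ⟨_, ⟨k + n, β n, hβ n, hαn ▸ hle n, rfl⟩, ?_⟩
  have h1 := (D.dist_newPoint_lt h (ω (k + n)) (hβ n)).le
  rw [h.quasi.symm] at h1
  refine (h.quasi.triangle_lt hA (hxβ n) h1).trans ?_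
  have h2 : δ ^ n ≤ δ ^ m := pow_le_pow_of_le_one h.pos.le h.lt_one.le hmn.le
  have h3 := (lt_div_iff₀ (by positivity)).1 (h2.trans_lt hm)
  rw [zpow_add₀ h.pos.ne', zpow_natCast]
  linarith

theorem closedCube_subset {D : DyadicData d A₀ δ L M} {ω : Param L M} {k : ℤ} {α β : X}
    (hβ : D.IsNewChild (ω k) k β α) : D.closedCube ω (k + 1) β ⊆ D.closedCube ω k α := by
  have : D.preCube ω (k + 1) β ⊆ D.preCube ω k α := by
    rintro _ ⟨ℓ, γ, hγ, hle, rfl⟩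
    exact ⟨ℓ, γ, hγ, hle.tail ⟨rfl, hβ⟩, rfl⟩
  exact @closure_mono X (quasiTopology d) _ _ this

/-- Some closed cube of generation `k + 1` contains `x`; its reference point is close to `x`, hence
to `α`, and so is a new child of `α`. -/
theorem mem_closedCube_of_dist_lt (h : IsAdmissible d A₀ δ) (D : DyadicData d A₀ δ L M)
    (ω : Param L M) {k : ℤ} {α x : X} (hα : α ∈ D.pts k) (hx : d α x < δ ^ k / (8 * A₀ ^ 3)) :
    x ∈ D.closedCube ω k α := by
  have hA := h.one_le
  have hu := h.zpow_pos k
  obtain ⟨β, hβ, hxβ⟩ := D.exists_mem_closedCube h ω (k + 1) x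
  refine closedCube_subset (D.isNewChild_of_dist_lt h (ω k) hβ hα ?_) hxβ
  have h1 := dist_lt_of_mem_closedCube h hxβ
  rw [h.quasi.symm] at hx
  refine (h.quasi.triangle_lt hA h1 hx.le).trans_le ?_
  rw [h.zpow_succ]
  have h2 := h.mul_pow_le (n := 8) (by norm_num)
  have h3 : δ * A₀ ^ 5 ≤ 1 / (64 * A₀ ^ 3) := by
    rw [le_div_iff₀ (by positivity)]
    calc δ * A₀ ^ 5 * (64 * A₀ ^ 3) = 64 * (δ * A₀ ^ 8) := by ring
      _ ≤ 1 := by linarith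
  calc A₀ * (8 * A₀ ^ 5 * (δ ^ k * δ) + δ ^ k / (8 * A₀ ^ 3))
      = A₀ * δ ^ k * (8 * (δ * A₀ ^ 5) + 1 / (8 * A₀ ^ 3)) := by ring
    _ ≤ A₀ * δ ^ k * (8 * (1 / (64 * A₀ ^ 3)) + 1 / (8 * A₀ ^ 3)) := by gcongr
    _ = δ ^ k / (4 * A₀ ^ 2) := by field_simp; norm_num

theorem self_mem_closedCube (h : IsAdmissible d A₀ δ) (D : DyadicData d A₀ δ L M)
    (ω : Param L M) {k : ℤ} {α : X} (hα : α ∈ D.pts k) : α ∈ D.closedCube ω k α := by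
  refine D.mem_closedCube_of_dist_lt h ω hα ?_
  have hA := h.one_le
  have hu := h.zpow_pos k
  rw [h.quasi.self]
  positivity

/-- A closed cube is the union of the closed cubes of its new children. -/
theorem mem_closedCube_iff (h : IsAdmissible d A₀ δ) (D : DyadicData d A₀ δ L M)
    (ω : Param L M) {k : ℤ} {α x : X} :
    x ∈ D.closedCube ω k α ↔ ∃ β, D.IsNewChild (ω k) k β α ∧ x ∈ D.closedCube ω (k + 1) β := by
  refine ⟨fun hx => ?_, fun ⟨β, hβ, hx⟩ => closedCube_subset hβ hx⟩
  have hα := mem_pts_of_mem_closedCube h hx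
  let _ := quasiTopology d
  set F := {β | D.IsNewChild (ω k) k β α}
  have hF : F.Finite := (D.finite_setOf_isNewChild h k α).subset fun β hβ => ⟨_, hβ⟩
  have hsub : D.preCube ω k α ⊆ ⋃ β ∈ F, D.closedCube ω (k + 1) β := by
    rintro _ ⟨ℓ, γ, hγ, hle, rfl⟩
    rw [Set.mem_iUnion₂]
    rcases Relation.ReflTransGen.cases_tail hle with heq | ⟨⟨j, β⟩, hle', hj, hβ⟩
    -- The point `z^k_α` is itself a reference point of generation `k + 1`, at distance zero from
    -- the new point of `α`.
    · obtain ⟨rfl, rfl⟩ := Prod.mk.inj heq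
      have hz := (D.isChild_newPoint h (ω k) hα).1
      refine ⟨_, ⟨hz, hα, Or.inl ?_⟩, D.self_mem_closedCube h ω hz⟩
      have hA := h.one_le
      have hu := h.zpow_pos k
      rw [h.quasi.self]
      positivity
    · obtain rfl : j = k + 1 := hj
      exact ⟨β, hβ, subset_closure (⟨ℓ, γ, hγ, hle', rfl⟩ : _ ∈ D.preCube ω (k + 1) β)⟩
  -- Finiteness of the set of children is what makes the union closed.
  have hcl : IsClosed (⋃ β ∈ F, D.closedCube ω (k + 1) β) :=
    hF.isClosed_biUnion fun β _ => isClosed_closure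
  have := closure_minimal hsub hcl hx
  simpa [F] using this

/-! ### One good coordinate forces a unique common cube -/

/-- For each point there is a value of a coordinate which puts all the cubes of the next generation
near that point into one cube. -/
theorem exists_coord (h : IsAdmissible d A₀ δ) (D : DyadicData d A₀ δ L M) (k : ℤ) (x : X) :
    ∃ c α, ∀ (ω : Param L M) (y γ : X), d x y ≤ δ ^ (k + 1) → y ∈ D.closedCube ω (k + 1) γ →
      D.IsNewChild c k γ α := by
  have hA := h.one_le
  have hu := h.zpow_pos k
  obtain ⟨β, hβ, hxβ⟩ := D.exists_pts_dist_lt h (k + 1) x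
  -- These labels put the new point of the parent of `β` exactly at `β`, a reference point near `x`.
  refine ⟨(D.label₁ k (D.parent k β), D.label₂ (k + 1) β), D.parent k β, fun ω y γ hxy hy => ?_⟩
  refine ⟨mem_pts_of_mem_closedCube h hy, D.parent_mem k β hβ, Or.inl ?_⟩
  rw [D.newPoint_label ⟨hβ, rfl⟩]
  have h1 := dist_lt_of_mem_closedCube h hy
  rw [h.quasi.symm] at hxy
  have h2 := h.quasi.triangle_le hA hxy hxβ.le
  refine (h.quasi.triangle_lt hA h1 h2).trans_le ?_
  rw [h.zpow_succ]
  have h3 := h.mul_pow_le (n := 8) (by norm_num)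
  have h4 : δ * A₀ ^ 6 ≤ 1 / (44 * A₀ ^ 2) := by
    rw [le_div_iff₀ (by positivity)]
    calc δ * A₀ ^ 6 * (44 * A₀ ^ 2) = 44 * (δ * A₀ ^ 8) := by ring
      _ ≤ 1 := by linarith
  have h5 : A₀ ^ 2 ≤ A₀ ^ 6 := pow_le_pow_right₀ hA (by norm_num)
  have h6 : A₀ ^ 3 ≤ A₀ ^ 6 := pow_le_pow_right₀ hA (by norm_num)
  have hδ := h.pos
  calc A₀ * (8 * A₀ ^ 5 * (δ ^ k * δ) + A₀ * (δ ^ k * δ + 2 * A₀ * (δ ^ k * δ)))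
      = δ ^ k * (δ * (8 * A₀ ^ 6 + A₀ ^ 2 + 2 * A₀ ^ 3)) := by ring
    _ ≤ δ ^ k * (δ * (8 * A₀ ^ 6 + A₀ ^ 6 + 2 * A₀ ^ 6)) := by gcongr
    _ = δ ^ k * (11 * (δ * A₀ ^ 6)) := by ring
    _ ≤ δ ^ k * (11 * (1 / (44 * A₀ ^ 2))) := by gcongr
    _ = δ ^ k / (4 * A₀ ^ 2) := by field_simp; norm_num

/-- If one coordinate between two generations has the right value, then nearby points lie in
exactly one cube of the earlier generation, and it is the same for both. -/
theorem exists_forall_mem_closedCube_iff (h : IsAdmissible d A₀ δ) (D : DyadicData d A₀ δ L M)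
    {x y : X} {c : ℤ → Fin (L + 1) × Fin M} {a : ℤ → X}
    (hc : ∀ (k : ℤ) (ω : Param L M) (y γ : X), d x y ≤ δ ^ (k + 1) →
      y ∈ D.closedCube ω (k + 1) γ → D.IsNewChild (c k) k γ (a k))
    (ω : Param L M) (j : ℕ) (k : ℤ) (hω : ω (k + j) = c (k + j)) (hxy : d x y ≤ δ ^ (k + j + 1)) :
    ∃ α, ∀ γ, (x ∈ D.closedCube ω k γ ↔ γ = α) ∧ (y ∈ D.closedCube ω k γ ↔ γ = α) := by
  induction j generalizing k with
  | zero =>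
    simp only [Nat.cast_zero, add_zero] at hω hxy
    have key : ∀ z, d x z ≤ δ ^ (k + 1) → ∀ γ, z ∈ D.closedCube ω k γ ↔ γ = a k := by
      intro z hz γ
      rw [D.mem_closedCube_iff h, hω]
      constructor
      · rintro ⟨β, hβ, hzβ⟩
        exact hβ.unique h (hc k ω z β hz hzβ)
      · rintro rfl
        obtain ⟨β, -, hzβ⟩ := D.exists_mem_closedCube h ω (k + 1) z
        exact ⟨β, hc k ω z β hz hzβ, hzβ⟩
    refine ⟨a k, fun γ => ⟨key x ?_ γ, key y hxy γ⟩⟩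
    rw [h.quasi.self]
    exact (h.zpow_pos _).le
  | succ j ih =>
    have hj : k + ((j + 1 : ℕ) : ℤ) = k + 1 + j := by push_cast; ring
    rw [hj] at hω hxy
    obtain ⟨β, hβ⟩ := ih (k + 1) hω hxy
    have hβmem : β ∈ D.pts (k + 1) := mem_pts_of_mem_closedCube h ((hβ β).1.2 rfl)
    obtain ⟨α, hα⟩ := D.exists_isNewChild (ω k) hβmem
    -- Once the cube of generation `k + 1` is unique, that of generation `k` is its new parent,
    -- whatever the value of `ω k`.
    have key : ∀ z, (∀ γ, z ∈ D.closedCube ω (k + 1) γ ↔ γ = β) →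
        ∀ γ, z ∈ D.closedCube ω k γ ↔ γ = α := by
      intro z hz γ
      rw [D.mem_closedCube_iff h]
      simp only [hz, exists_eq_right]
      exact ⟨fun hγ => hγ.unique h hα, fun hγ => hγ ▸ hα⟩
    exact ⟨α, fun γ => ⟨key x (fun γ => (hβ γ).1) γ, key y (fun γ => (hβ γ).2) γ⟩⟩

end DyadicData
end QuasiSpline

namespace QuasiSpline

/-! ### Independence in the parameter space -/

open MeasureTheory ProbabilityTheory

/-- In a finite measure space, the measure of a countable union of almost disjoint sets. -/
theorem hasSum_measureReal_iUnion {Ω ι : Type*} [MeasurableSpace Ω] {μ : Measure Ω}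
    [IsFiniteMeasure μ] [Countable ι] {A : ι → Set Ω}
    (hd : Pairwise (Function.onFun (AEDisjoint μ) A)) (hA : ∀ i, MeasurableSet (A i)) :
    HasSum (fun i => μ.real (A i)) (μ.real (⋃ i, A i)) := by
  have h := measure_iUnion₀ hd fun i => (hA i).nullMeasurableSet
  rw [Measure.real, h, ENNReal.tsum_toReal_eq fun i => measure_ne_top μ _]
  exact (ENNReal.summable_toReal (h ▸ measure_ne_top μ _)).hasSum

/-- The events that depend only on the coordinates from `k` on. -/
abbrev tailSigma (L M : ℕ) (k : ℤ) : MeasurableSpace (Param L M) :=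
  ⨆ i ∈ Set.Ici k, MeasurableSpace.comap (fun ω : Param L M => ω i) inferInstance

theorem tailSigma_le (L M : ℕ) (k : ℤ) : tailSigma L M k ≤ MeasurableSpace.pi :=
  iSup₂_le fun i _ => (measurable_pi_apply i).comap_le

theorem measurableSet_comap_eval {L M : ℕ} (i : ℤ) (P : Fin (L + 1) × Fin M → Prop) :
    MeasurableSet[MeasurableSpace.comap (fun ω : Param L M => ω i) inferInstance]
      {ω | P (ω i)} :=
  ⟨{c | P c}, .of_discrete, rfl⟩

theorem measurableSet_tailSigma_eval {L M : ℕ} {k i : ℤ} (hi : k ≤ i)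
    (P : Fin (L + 1) × Fin M → Prop) : MeasurableSet[tailSigma L M k] {ω | P (ω i)} :=
  le_iSup₂ (f := fun (i : ℤ) (_ : i ∈ Set.Ici k) =>
    MeasurableSpace.comap (fun ω : Param L M => ω i) inferInstance) i hi _
    (measurableSet_comap_eval i P)

instance (L M : ℕ) [NeZero M] : IsProbabilityMeasure (paramProb L M) := by
  unfold paramProb
  infer_instance

/-- A coordinate is independent of the later coordinates. -/
theorem indep_comap_eval_tailSigma (L M : ℕ) [NeZero M] (k : ℤ) :
    Indep (MeasurableSpace.comap (fun ω : Param L M => ω k) inferInstance)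
      (tailSigma L M (k + 1)) (paramProb L M) := by
  have h1 : iIndepFun (fun (i : ℤ) (ω : Param L M) => ω i) (paramProb L M) :=
    iIndepFun_infinitePi (X := fun _ ω => ω) fun _ => measurable_id
  have h2 := indep_iSup_of_disjoint (fun i => (measurable_pi_apply i).comap_le) h1.iIndep
    (S := {k}) (T := Set.Ici (k + 1)) (by simp)
  simpa only [Set.mem_singleton_iff, iSup_iSup_eq_left] using h2

/-- The probability that a finite number of coordinates all avoid prescribed values. -/
theorem paramProb_forall_ne {L M : ℕ} [NeZero M] (c : ℤ → Fin (L + 1) × Fin M) (k : ℤ) (m : ℕ) :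
    (paramProb L M).real {ω | ∀ j < m, ω (k + j) ≠ c (k + j)} =
      (1 - 1 / (((L : ℝ) + 1) * (M : ℝ))) ^ m := by
  classical
  set s : Finset ℤ := (Finset.range m).map
    ⟨fun j : ℕ => k + j, fun i j hij => by simpa using hij⟩
  have hset : {ω : Param L M | ∀ j < m, ω (k + j) ≠ c (k + j)} =
      Set.pi s fun i => {c i}ᶜ := by
    ext ω
    simp only [s, Finset.coe_map, Set.mem_pi, Set.forall_mem_image, Finset.coe_range, Set.mem_Iio]
    rfl
  have hone : ∀ a : Fin (L + 1) × Fin M,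
      (PMF.uniformOfFintype (Fin (L + 1) × Fin M)).toMeasure.real {a}ᶜ =
        1 - 1 / (((L : ℝ) + 1) * (M : ℝ)) := by
    intro a
    rw [probReal_compl_eq_one_sub (measurableSet_singleton a), Measure.real,
      PMF.toMeasure_apply_singleton _ _ (measurableSet_singleton a), PMF.uniformOfFintype_apply,
      ENNReal.toReal_inv, ENNReal.toReal_natCast, one_div]
    simp
  rw [hset, Measure.real, paramProb, Measure.infinitePi_pi _ fun i _ => .of_discrete,
    ENNReal.toReal_prod]
  change ∏ i ∈ s, (PMF.uniformOfFintype (Fin (L + 1) × Fin M)).toMeasure.real {c i}ᶜ = _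
  simp [hone, s]

namespace DyadicData

variable {X : Type*} {d : X → X → ℝ} {A₀ δ : ℝ} {L M : ℕ}

/-! ### Measurability of the cube events -/

/-- A chain from generation `k + n` down to `k` uses only coordinates with index at least `k`.
Measurability for the tail σ-algebra is needed for independence in the refinement equation. -/
theorem measurableSet_newLE (h : IsAdmissible d A₀ δ) (D : DyadicData d A₀ δ L M) (k : ℤ) (α : X)
    (n : ℕ) {β : X} (hβ : β ∈ D.pts (k + n)) :
    MeasurableSet[tailSigma L M k] {ω | D.NewLE ω (k + n, β) (k, α)} := by
  induction n generalizing β with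
  | zero =>
    have : {ω | D.NewLE ω (k + (0 : ℕ), β) (k, α)} = {_ω : Param L M | β = α} := by
      ext ω
      simp only [Nat.cast_zero, add_zero, Set.mem_ofPred_eq]
      constructor
      · intro hle
        rcases Relation.ReflTransGen.cases_head hle with heq | ⟨⟨j, γ⟩, ⟨hj, hγ⟩, hle'⟩
        · exact (Prod.mk.inj heq).2
        · have h1 : k ≤ j := (NewLE.bound h hle' hγ.2.1).1
          have h2 : k = j + 1 := hj
          omega
      · rintro rfl
        exact .refl
    rw [this]
    exact @MeasurableSet.const _ (tailSigma L M k) _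
  | succ n ih =>
    have hn : k + ((n + 1 : ℕ) : ℤ) = k + n + 1 := by push_cast; ring
    rw [hn] at hβ ⊢
    have : {ω | D.NewLE ω (k + n + 1, β) (k, α)} = ⋃ γ ∈ D.pts (k + n),
        {ω | D.IsNewChild (ω (k + n)) (k + n) β γ} ∩ {ω | D.NewLE ω (k + n, γ) (k, α)} := by
      ext ω
      simp only [Set.mem_ofPred_eq, Set.mem_iUnion, Set.mem_inter_iff, exists_prop]
      constructor
      · intro hle
        rcases Relation.ReflTransGen.cases_head hle with heq | ⟨⟨j, γ⟩, ⟨hj, hγ⟩, hle'⟩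
        · have := (Prod.mk.inj heq).1
          omega
        · obtain rfl : j = k + n := by
            have h2 : k + n + 1 = j + 1 := hj
            omega
          exact ⟨γ, hγ.2.1, hγ, hle'⟩
      · rintro ⟨γ, -, hγ, hle⟩
        exact Relation.ReflTransGen.head ⟨rfl, hγ⟩ hle
    rw [this]
    refine MeasurableSet.biUnion (D.countable_pts h _) fun γ hγ => ?_
    exact (measurableSet_tailSigma_eval (by omega)
      fun c => D.IsNewChild c (k + n) β γ).inter (ih hγ)

theorem measurableSet_tailSigma_mem_closedCube (h : IsAdmissible d A₀ δ)
    (D : DyadicData d A₀ δ L M) (k : ℤ) (α x : X) :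
    MeasurableSet[tailSigma L M k] {ω | x ∈ D.closedCube ω k α} := by
  -- Closure membership becomes a countable condition: radii `1 / (n + 1)` suffice and each
  -- generation is countable.
  have : {ω | x ∈ D.closedCube ω k α} = ⋂ n : ℕ, ⋃ m : ℕ, ⋃ β ∈ D.pts (k + m),
      {ω | D.NewLE ω (k + m, β) (k, α)} ∩
        {ω | d x (D.newPoint (ω (k + m)) (k + m) β) < 1 / ((n : ℝ) + 1)} := by
    ext ω
    simp only [closedCube, mem_qClosure_iff h.quasi h.one_le, Set.mem_ofPred_eq, Set.mem_iInter,
      Set.mem_iUnion, Set.mem_inter_iff, exists_prop]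
    constructor
    · intro hx n
      obtain ⟨_, ⟨ℓ, β, hβ, hle, rfl⟩, hlt⟩ := hx (1 / ((n : ℝ) + 1)) (by positivity)
      have hk : k ≤ ℓ := (hle.bound h hβ).1
      obtain ⟨m, rfl⟩ := Int.le.dest hk
      exact ⟨m, β, hβ, hle, hlt⟩
    · intro hx ε hε
      obtain ⟨n, hn⟩ := exists_nat_one_div_lt hε
      obtain ⟨m, β, hβ, hle, hlt⟩ := hx n
      exact ⟨_, ⟨_, β, hβ, hle, rfl⟩, hlt.trans hn⟩
  rw [this]
  refine MeasurableSet.iInter fun n => MeasurableSet.iUnion fun m =>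
    MeasurableSet.biUnion (D.countable_pts h _) fun β hβ => ?_
  exact (D.measurableSet_newLE h k α m hβ).inter (measurableSet_tailSigma_eval (by omega)
    fun c => d x (D.newPoint c (k + m) β) < 1 / ((n : ℝ) + 1))

theorem measurableSet_mem_closedCube (h : IsAdmissible d A₀ δ) (D : DyadicData d A₀ δ L M)
    (k : ℤ) (α x : X) : MeasurableSet {ω | x ∈ D.closedCube ω k α} :=
  tailSigma_le L M k _ (D.measurableSet_tailSigma_mem_closedCube h k α x)

theorem measurableSet_isNewChild (D : DyadicData d A₀ δ L M) (k : ℤ) (β α : X) :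
    MeasurableSet {ω : Param L M | D.IsNewChild (ω k) k β α} :=
  (measurable_pi_apply k).comap_le _ (measurableSet_comap_eval k fun c => D.IsNewChild c k β α)

variable [NeZero M]

/-! ### Geometric decay and almost sure disjointness -/

/-- The probability that two nearby points do not lie in the same unique cube decays
geometrically. -/
theorem exists_compl_prob_le (h : IsAdmissible d A₀ δ) (D : DyadicData d A₀ δ L M) (k : ℤ) (m : ℕ)
    {x y : X} (hxy : d x y ≤ δ ^ (k + m)) :
    ∃ B : Set (Param L M),
      (paramProb L M).real B ≤ (1 - 1 / (((L : ℝ) + 1) * (M : ℝ))) ^ m ∧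
      ∀ ω ∉ B, ∃ α, ∀ γ,
        (x ∈ D.closedCube ω k γ ↔ γ = α) ∧ (y ∈ D.closedCube ω k γ ↔ γ = α) := by
  choose c a hc using fun k => D.exists_coord h k x
  refine ⟨_, (paramProb_forall_ne c k m).le, fun ω hω => ?_⟩
  simp only [Set.mem_ofPred_eq, not_forall, not_not] at hω
  obtain ⟨j, hj, hωj⟩ := hω
  -- A good coordinate `k + j` needs `d x y ≤ δ ^ (k + j + 1)`, which holds for every `j < m`.
  exact D.exists_forall_mem_closedCube_iff h hc ω j k hωj
    (hxy.trans (h.zpow_le_zpow (by omega)))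

theorem one_sub_inv_mem_Ico (L M : ℕ) [NeZero M] :
    0 ≤ 1 - 1 / (((L : ℝ) + 1) * (M : ℝ)) ∧ 1 - 1 / (((L : ℝ) + 1) * (M : ℝ)) < 1 := by
  have hM : (1 : ℝ) ≤ M := by exact_mod_cast NeZero.one_le
  have hL : (1 : ℝ) ≤ (L : ℝ) + 1 := by linarith [(Nat.cast_nonneg L : (0 : ℝ) ≤ L)]
  have hLM := one_le_mul_of_one_le_of_one_le hL hM
  have h1 : 1 / (((L : ℝ) + 1) * (M : ℝ)) ≤ 1 := by
    rw [div_le_one (by linarith)]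
    exact hLM
  have h2 : 0 < 1 / (((L : ℝ) + 1) * (M : ℝ)) := by positivity
  constructor <;> linarith

/-- The decay estimate for the pair `x, x` holds for every `m`, since `d x x = 0`; let `m → ∞`. -/
theorem aedisjoint_closedCube (h : IsAdmissible d A₀ δ) (D : DyadicData d A₀ δ L M) {k : ℤ}
    {α β : X} (hne : α ≠ β) (x : X) :
    AEDisjoint (paramProb L M) {ω | x ∈ D.closedCube ω k α} {ω | x ∈ D.closedCube ω k β} := by
  have hle : ∀ m : ℕ, (paramProb L M).real
      ({ω | x ∈ D.closedCube ω k α} ∩ {ω | x ∈ D.closedCube ω k β}) ≤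
        (1 - 1 / (((L : ℝ) + 1) * (M : ℝ))) ^ m := by
    intro m
    obtain ⟨B, hB, hω⟩ := D.exists_compl_prob_le h k m
      (show d x x ≤ δ ^ (k + m) from (h.quasi.self x).trans_le (h.zpow_pos _).le)
    refine (measureReal_mono fun ω hmem => ?_).trans hB
    obtain ⟨h1, h2⟩ := hmem
    by_contra hωB
    obtain ⟨γ, hγ⟩ := hω ω hωB
    exact hne (((hγ α).1.1 h1).trans ((hγ β).1.1 h2).symm)
  obtain ⟨h0, h1⟩ := one_sub_inv_mem_Ico L M
  have := ge_of_tendsto' (tendsto_pow_atTop_nhds_zero_of_lt_one h0 h1) hle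
  exact (measureReal_eq_zero_iff (measure_ne_top _ _)).1 (this.antisymm measureReal_nonneg)

/-! ### Partition of unity, support, interpolation and refinement -/

theorem hasSum_spline (h : IsAdmissible d A₀ δ) (D : DyadicData d A₀ δ L M) (k : ℤ) (x : X) :
    HasSum (fun α : D.pts k => D.spline k α x) 1 := by
  have := (D.countable_pts h k).to_subtype
  have hsum := hasSum_measureReal_iUnion (μ := paramProb L M)
    (A := fun α : D.pts k => {ω | x ∈ D.closedCube ω k α})
    (fun α β hne => D.aedisjoint_closedCube h (Subtype.coe_injective.ne hne) x)
    fun α => D.measurableSet_mem_closedCube h k α x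
  have huniv : ⋃ α : D.pts k, {ω | x ∈ D.closedCube ω k α} = Set.univ := by
    refine Set.eq_univ_of_forall fun ω => ?_
    obtain ⟨α, hα, hx⟩ := D.exists_mem_closedCube h ω k x
    exact Set.mem_iUnion.2 ⟨⟨α, hα⟩, hx⟩
  rw [huniv, probReal_univ] at hsum
  exact hsum

theorem spline_eq_one (h : IsAdmissible d A₀ δ) (D : DyadicData d A₀ δ L M) {k : ℤ} {α x : X}
    (hα : α ∈ D.pts k) (hx : d α x < δ ^ k / (8 * A₀ ^ 3)) : D.spline k α x = 1 := by
  have : {ω | x ∈ D.closedCube ω k α} = Set.univ :=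
    Set.eq_univ_of_forall fun ω => D.mem_closedCube_of_dist_lt h ω hα hx
  rw [spline, this, probReal_univ]

theorem spline_eq_zero (h : IsAdmissible d A₀ δ) (D : DyadicData d A₀ δ L M) {k : ℤ} {α x : X}
    (hx : ¬ d α x < 8 * A₀ ^ 5 * δ ^ k) : D.spline k α x = 0 := by
  have : {ω | x ∈ D.closedCube ω k α} = ∅ :=
    Set.eq_empty_of_forall_notMem fun ω hω => hx (dist_lt_of_mem_closedCube h hω)
  rw [spline, this, measureReal_empty]

theorem spline_self (h : IsAdmissible d A₀ δ) (D : DyadicData d A₀ δ L M) {k : ℤ} {α : X}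
    (hα : α ∈ D.pts k) : D.spline k α α = 1 := by
  refine D.spline_eq_one h hα ?_
  have hA := h.one_le
  have hu := h.zpow_pos k
  rw [h.quasi.self]
  positivity

/-- The point `β` always lies in its own cube, so lying in that of `α` as well is a null event. -/
theorem spline_of_ne (h : IsAdmissible d A₀ δ) (D : DyadicData d A₀ δ L M) {k : ℤ} {α β : X}
    (hβ : β ∈ D.pts k) (hne : α ≠ β) : D.spline k α β = 0 := by
  have hsub : {ω | β ∈ D.closedCube ω k α} ⊆
      {ω | β ∈ D.closedCube ω k α} ∩ {ω | β ∈ D.closedCube ω k β} :=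
    fun ω hω => ⟨hω, D.self_mem_closedCube h ω hβ⟩
  exact (measureReal_eq_zero_iff (measure_ne_top _ _)).2 (measure_mono_null hsub (D.aedisjoint_closedCube h hne β))

/-- The refinement coefficients: the probability that `(k + 1, β)` is a new child of `(k, α)`. -/
noncomputable def refinementCoeff (D : DyadicData d A₀ δ L M) (k : ℤ) (α β : X) : ℝ :=
  (paramProb L M).real {ω | D.IsNewChild (ω k) k β α}

theorem finite_refinementCoeff_ne_zero (h : IsAdmissible d A₀ δ) (D : DyadicData d A₀ δ L M)
    (k : ℤ) (α : X) : {β : D.pts (k + 1) | D.refinementCoeff k α β ≠ 0}.Finite := by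
  refine ((D.finite_setOf_isNewChild h k α).preimage
    Subtype.coe_injective.injOn).subset fun β hβ => ?_
  by_contra hno
  have : {ω : Param L M | D.IsNewChild (ω k) k β α} = ∅ :=
    Set.eq_empty_of_forall_notMem fun ω hω => hno ⟨ω k, hω⟩
  exact hβ (by rw [refinementCoeff, this, measureReal_empty])

theorem hasSum_refinementCoeff (h : IsAdmissible d A₀ δ) (D : DyadicData d A₀ δ L M) (k : ℤ)
    {β : X} (hβ : β ∈ D.pts (k + 1)) :
    HasSum (fun α : D.pts k => D.refinementCoeff k α β) 1 := by
  have := (D.countable_pts h k).to_subtype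
  have hsum := hasSum_measureReal_iUnion (μ := paramProb L M)
    (A := fun α : D.pts k => {ω | D.IsNewChild (ω k) k β α})
    (fun α γ hne => (Set.disjoint_left.2 fun ω h1 h2 =>
      hne (Subtype.coe_injective (IsNewChild.unique h h1 h2))).aedisjoint)
    fun α => D.measurableSet_isNewChild k β α
  have huniv : ⋃ α : D.pts k, {ω : Param L M | D.IsNewChild (ω k) k β α} = Set.univ := by
    refine Set.eq_univ_of_forall fun ω => ?_
    obtain ⟨α, hα⟩ := D.exists_isNewChild (ω k) hβ
    exact Set.mem_iUnion.2 ⟨⟨α, hα.2.1⟩, hα⟩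
  rw [huniv, probReal_univ] at hsum
  exact hsum

/-- The event for `α` splits over new children `β` into almost disjoint pieces; each is an event of
`ω k` intersected with an event of later coordinates. -/
theorem hasSum_refinement (h : IsAdmissible d A₀ δ) (D : DyadicData d A₀ δ L M) (k : ℤ)
    (α x : X) :
    HasSum (fun β : D.pts (k + 1) => D.refinementCoeff k α β * D.spline (k + 1) β x)
      (D.spline k α x) := by
  have := (D.countable_pts h (k + 1)).to_subtype
  have hsum := hasSum_measureReal_iUnion (μ := paramProb L M)
    (A := fun β : D.pts (k + 1) =>
      {ω | D.IsNewChild (ω k) k β α} ∩ {ω | x ∈ D.closedCube ω (k + 1) β})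
    (fun β γ hne => (D.aedisjoint_closedCube h (Subtype.coe_injective.ne hne) x).mono
      Set.inter_subset_right Set.inter_subset_right)
    fun β => (D.measurableSet_isNewChild k β α).inter (D.measurableSet_mem_closedCube h _ β x)
  have hunion : ⋃ β : D.pts (k + 1),
      {ω | D.IsNewChild (ω k) k β α} ∩ {ω | x ∈ D.closedCube ω (k + 1) β} =
        {ω | x ∈ D.closedCube ω k α} := by
    ext ω
    simp only [Set.mem_iUnion, Set.mem_inter_iff, Set.mem_ofPred_eq, Subtype.exists, exists_prop]
    rw [D.mem_closedCube_iff h]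
    exact ⟨fun ⟨β, _, hβ⟩ => ⟨β, hβ⟩, fun ⟨β, hβ⟩ => ⟨β, hβ.1.1, hβ⟩⟩
  rw [hunion] at hsum
  have hmul : ∀ β : D.pts (k + 1), (paramProb L M).real
      ({ω | D.IsNewChild (ω k) k β α} ∩ {ω | x ∈ D.closedCube ω (k + 1) β}) =
        D.refinementCoeff k α β * D.spline (k + 1) β x := by
    intro β
    have hind := (Indep_iff _ _ _).1 (indep_comap_eval_tailSigma L M k) _ _
      (measurableSet_comap_eval k fun c => D.IsNewChild c k β α)
      (D.measurableSet_tailSigma_mem_closedCube h (k + 1) β x)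
    rw [refinementCoeff, spline, Measure.real, Measure.real, Measure.real, hind,
      ENNReal.toReal_mul]
  simp only [hmul] at hsum
  exact hsum

/-! ### Hölder continuity -/

theorem abs_spline_sub_le (h : IsAdmissible d A₀ δ) (D : DyadicData d A₀ δ L M) (k : ℤ)
    (α : X) (m : ℕ) {x y : X} (hxy : d x y ≤ δ ^ (k + m)) :
    |D.spline k α x - D.spline k α y| ≤ (1 - 1 / (((L : ℝ) + 1) * (M : ℝ))) ^ m := by
  obtain ⟨B, hB, hω⟩ := D.exists_compl_prob_le h k m hxy
  refine (abs_measureReal_sub_le_measureReal_symmDiff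
    (D.measurableSet_mem_closedCube h k α x).nullMeasurableSet
    (D.measurableSet_mem_closedCube h k α y).nullMeasurableSet).trans
    ((measureReal_mono fun ω hmem => ?_).trans hB)
  by_contra hωB
  obtain ⟨γ, hγ⟩ := hω ω hωB
  have : x ∈ D.closedCube ω k α ↔ y ∈ D.closedCube ω k α := (hγ α).1.trans (hγ α).2.symm
  rcases hmem with ⟨h1, h2⟩ | ⟨h1, h2⟩
  · exact h2 (this.1 h1)
  · exact h2 (this.2 h1)

theorem abs_spline_sub_le_rpow (h : IsAdmissible d A₀ δ) (D : DyadicData d A₀ δ L M) {η : ℝ}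
    (hη : 0 < η) (hle : 1 - 1 / (((L : ℝ) + 1) * (M : ℝ)) ≤ δ ^ η) (k : ℤ) (α x y : X) :
    |D.spline k α x - D.spline k α y| ≤ δ ^ (-η) * (d x y / δ ^ k) ^ η := by
  have hu := h.zpow_pos k
  have hδ := h.pos
  rcases eq_or_ne x y with rfl | hne
  · have := h.quasi.nonneg x x
    rw [sub_self, abs_zero]
    positivity
  have ht : 0 < d x y / δ ^ k := by
    have := (h.quasi.nonneg x y).lt_of_ne fun h0 => hne ((h.quasi.eq_zero_iff x y).1 h0.symm)
    positivity
  rcases lt_or_ge 1 (d x y / δ ^ k) with h1 | h1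
  · have h2 : |D.spline k α x - D.spline k α y| ≤ 1 := by
      have h0 : ∀ z, 0 ≤ D.spline k α z := fun z => measureReal_nonneg
      have h1 : ∀ z, D.spline k α z ≤ 1 := fun z => measureReal_le_one
      rw [abs_le]
      constructor <;> linarith [h0 x, h0 y, h1 x, h1 y]
    exact h2.trans (one_le_mul_of_one_le_of_one_le
      (Real.one_le_rpow_of_pos_of_le_one_of_nonpos hδ h.lt_one.le (by linarith))
      (Real.one_le_rpow h1.le hη.le))
  -- Here `δ ^ (m + 1) < d x y / δ ^ k ≤ δ ^ m`; the constant `δ ^ (-η)` pays for the gap between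
  -- the two powers.
  obtain ⟨m, hm1, hm2⟩ := exists_nat_pow_near_of_lt_one ht h1 hδ h.lt_one
  have hxy : d x y ≤ δ ^ (k + m) := by
    rw [zpow_add₀ hδ.ne', zpow_natCast, mul_comm]
    exact (div_le_iff₀ hu).1 hm2
  calc |D.spline k α x - D.spline k α y|
      ≤ (1 - 1 / (((L : ℝ) + 1) * (M : ℝ))) ^ m := D.abs_spline_sub_le h k α m hxy
    _ ≤ (δ ^ η) ^ m := by gcongr; exact (one_sub_inv_mem_Ico L M).1
    _ = δ ^ (-η) * (δ ^ (m + 1)) ^ η := by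
      rw [← Real.rpow_natCast, ← Real.rpow_natCast, ← Real.rpow_mul hδ.le, ← Real.rpow_mul hδ.le,
        ← Real.rpow_add hδ]
      congr 1
      push_cast
      ring
    _ ≤ δ ^ (-η) * (d x y / δ ^ k) ^ η := by gcongr

end DyadicData

end QuasiSpline

/-! ### The main theorem -/

theorem mainTheorem6 (A₀ δ : ℝ) (L M : ℕ) [NeZero M] (hA₀ : 1 ≤ A₀) (hδ : 0 < δ)
    (hδ_le : δ ≤ 1 / (1000 * A₀ ^ 10)) :
    ∃ η C : ℝ, 0 < η ∧ η ≤ 1 ∧ 0 < C ∧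
      ((L + 1) * M ≠ 1 →
        η = Real.log (1 - 1 / (((L : ℝ) + 1) * (M : ℝ))) / Real.log δ) ∧
      ∀ (X : Type*) (d : X → X → ℝ), QuasiSpline.IsQuasiDist d A₀ →
        QuasiSpline.IsGeomDoubling d →
        ∀ D : QuasiSpline.DyadicData d A₀ δ L M, ∀ k : ℤ,
          -- the events that define the splines are measurable
          (∀ α ∈ D.pts k, ∀ x : X, MeasurableSet {ω | x ∈ D.closedCube ω k α}) ∧
          -- bounded support
          (∀ α ∈ D.pts k, ∀ x : X,
            Set.indicator (QuasiSpline.qBall d α (δ ^ k / (8 * A₀ ^ 3))) (fun _ => (1 : ℝ)) x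
                ≤ D.spline k α x ∧
              D.spline k α x ≤
                Set.indicator (QuasiSpline.qBall d α (8 * A₀ ^ 5 * δ ^ k)) (fun _ => (1 : ℝ)) x) ∧
          -- interpolation
          (∀ α ∈ D.pts k, D.spline k α α = 1) ∧
          (∀ α ∈ D.pts k, ∀ β ∈ D.pts k, α ≠ β → D.spline k α β = 0) ∧
          -- partition of unity
          (∀ x : X, HasSum (fun α : D.pts k => D.spline k α x) 1) ∧
          -- refinement
          (∃ p : D.pts k → D.pts (k + 1) → ℝ,
            (∀ α β, 0 ≤ p α β) ∧
            (∀ α, {β | p α β ≠ 0}.Finite) ∧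
            (∀ β, HasSum (fun α => p α β) 1) ∧
            ∀ (α : D.pts k) (x : X),
              HasSum (fun β : D.pts (k + 1) => p α β * D.spline (k + 1) β x)
                (D.spline k α x)) ∧
          -- Hölder continuity
          (∀ α ∈ D.pts k, ∀ x y : X,
            |D.spline k α x - D.spline k α y| ≤ C * (d x y / δ ^ k) ^ η) := by
  have hη : ∃ η : ℝ, 0 < η ∧ η ≤ 1 ∧ ((L + 1) * M ≠ 1 →
      η = Real.log (1 - 1 / (((L : ℝ) + 1) * (M : ℝ))) / Real.log δ) ∧
      1 - 1 / (((L : ℝ) + 1) * (M : ℝ)) ≤ δ ^ η := by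
    by_cases h1 : (L + 1) * M = 1
    -- With a single parameter value the decay rate is zero, so any positive exponent works.
    · refine ⟨1, one_pos, le_rfl, fun h => absurd h1 h, ?_⟩
      have : ((L : ℝ) + 1) * M = 1 := by exact_mod_cast h1
      rw [this]
      simpa using hδ.le
    · have h2 : 2 ≤ (L + 1) * M := by
        have : 0 < (L + 1) * M := Nat.mul_pos L.succ_pos (NeZero.pos M)
        omega
      have h3 : (2 : ℝ) ≤ ((L : ℝ) + 1) * M := by exact_mod_cast h2
      set n : ℝ := ((L : ℝ) + 1) * M
      have h4 : 1 / n ≤ 1 / 2 := one_div_le_one_div_of_le two_pos h3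
      have h5 : 0 < 1 / n := by positivity
      have h6 : δ ≤ 1 / 2 := by
        refine hδ_le.trans (one_div_le_one_div_of_le two_pos ?_)
        linarith [one_le_pow₀ hA₀ (n := 10)]
      have h7 : Real.log δ < 0 := Real.log_neg hδ (by linarith)
      have h8 : Real.log (1 - 1 / n) < 0 := Real.log_neg (by linarith) (by linarith)
      -- This exponent solves `δ ^ η = 1 - 1 / n`; it is at most one since `δ ≤ 1 / 2 ≤ 1 - 1 / n`.
      refine ⟨_, div_pos_of_neg_of_neg h8 h7, ?_, fun _ => rfl, ?_⟩
      · rw [div_le_one_of_neg h7]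
        exact Real.log_le_log hδ (by linarith)
      · rw [Real.rpow_def_of_pos hδ, mul_div_cancel₀ _ h7.ne, Real.exp_log (by linarith)]
  obtain ⟨η, hη0, hη1, hηeq, hηle⟩ := hη
  refine ⟨η, δ ^ (-η), hη0, hη1, Real.rpow_pos_of_pos hδ _, hηeq, fun X d hd hdbl D k => ?_⟩
  have h : QuasiSpline.IsAdmissible d A₀ δ := ⟨hd, hdbl, hA₀, hδ, hδ_le⟩
  refine ⟨fun α _ x => D.measurableSet_mem_closedCube h k α x, fun α hα x => ⟨?_, ?_⟩,
    fun α hα => D.spline_self h hα, fun α _ β hβ hne => D.spline_of_ne h hβ hne,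
    D.hasSum_spline h k, ⟨fun α β => D.refinementCoeff k α β,
      fun α β => MeasureTheory.measureReal_nonneg,
      fun α => D.finite_refinementCoeff_ne_zero h k α,
      fun β => D.hasSum_refinementCoeff h k β.2,
      fun α x => D.hasSum_refinement h k α x⟩,
    fun α _ x y => D.abs_spline_sub_le_rpow h hη0 hηle k α x y⟩
  · refine Set.indicator_apply_le' (fun hx => (D.spline_eq_one h hα hx).ge)
      fun _ => MeasureTheory.measureReal_nonneg
  · refine Set.le_indicator_apply (fun _ => MeasureTheory.measureReal_le_one)
      fun hx => (D.spline_eq_zero h hx).le
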